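/- **Setting.** Let $(\mathcal S,\mathcal A,P,\rho,\gamma)$ be a finite Markov decision process with deterministic rewards $\rho(s,a)$ and discount $\gamma\in(0,1)$, let $\pi$ be a policy, $P^\pi(s,s')=\sum_a\pi(s,a)P(s'|s,a)$, $\rho^\pi(s)=\sum_a\pi(s,a)\rho(s,a)$, and let $d$ be a distribution on $\mathcal S$. A random transition is $(s,r,s')$ with $s\sim d$, $r=\rho^\pi(s)$, $s'\sim P^\pi(s,\cdot)$. Let $z_j=V_{\min}+(j-1)\frac{V_{\max}-V_{\min}}{m-1}$, $1\le j\le m$, and let the distribution function be approximated linearly, $F_\theta(s,z)=\phi(s,z)^T\theta$, with $\phi(s,z),\theta\in\mathbb R^k$. For a transition put $$\hat A=\sum_{j=1}^m\phi(s,z_j)\Big(\phi(s,z_j)-\phi\big(s',\tfrac{z_j-r}{\gamma}\big)\Big)^T,\qquad \hat C=\sum_{j=1}^m\phi(s,z_j)\phi(s,z_j)^T,$$ and $A=\mathbb E\hat A$, $C=\mathbb E\hat C$, $L(\theta,w)=-\langle A\theta,w\rangle-\frac12 w^TCw$. Let $\Theta,W\subset\mathbb R^k$ be compact and convex, with Euclidean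 projections $\Pi_\Theta,\Pi_W$, let $R=\max\{\max_{\theta\in\Theta}\|\theta\|,\max_{w\in W}\|w\|\}$, and $$\mathrm{Err}(\theta',w')=\max_{w\in W}L(\theta',w)-\min_{\theta\in\Theta}L(\theta,w').$$ **Algorithm.** Let $(s_t,r_t,s_t')_{t\ge0}$ be independent random transitions, and let $\delta_{\theta}(t,j)=F_\theta(s'_t,\frac{z_j-r_t}{\gamma})-F_\theta(s_t,z_j)$. From any initial point $(\theta_0,w_0)\in\mathbb R^k\times\mathbb R^k$, projected distributional GTD2 computes $$w_{t+1}=\Pi_W\Big(w_t+\alpha_t\sum_{j=1}^m\big(-\phi(s_t,z_j)^Tw_t+\delta_{\theta_t}(t,j)\big)\phi(s_t,z_j)\Big),$$ $$\theta_{t+1}=\Pi_\Theta\Big(\theta_t+\alpha_t\sum_{j=1}^m\big(\phi(s_t,z_j)-\phi(s'_t,\tfrac{z_j-r_t}{\gamma})\big)\phi(s_t,z_j)^Tw_t\Big),$$ and its output after $n$ iterations is $\bar\theta_n=\sum_{t=1}^n\alpha_t\theta_t/\sum_{t=1}^n\alpha_t$, $\bar w_n=\sum_{t=1}^n\alpha_tw_t/\sum_{t=1}^n\alpha_t$.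 **Proposition.** Assume that a saddle point of $\min_{\theta\in\mathbb R^k}\max_{w\in\mathbb R^k}L(\theta,w)$ lies in $\Theta\times W$, that $A$ and $C$ are nonsingular, and that the stochastic gradients have bounded variance: for all $\theta\in\Theta$, $w\in W$, $$\mathbb E\|\hat A^Tw-A^Tw\|^2\le\sigma_1^2,\qquad \mathbb E\|(\hat A\theta+\hat Cw)-(A\theta+Cw)\|^2\le\sigma_2^2 .$$ Put $S=\sqrt{\sigma_1^2+\sigma_2^2+3\|A\|_2^2R^2+2\sigma_{\max}(C)^2R^2}$, where $\|\cdot\|_2$ is the spectral norm and $\sigma_{\max}$ the largest singular value. For $0<\delta<1$ and every $n\ge1$, run the algorithm with the constant step size $\alpha_t=\frac{4R}{\sqrt{10n}\,S}$ (read as $0$ if $S=0$; then $R=0$). Then, with probability at least $1-\delta$, $$\mathrm{Err}(\bar\theta_n,\bar w_n)\le\sqrt{\frac{10}{n}}\,\Big(8+2\log\frac2\delta\Big)R\,\sqrt{\sigma_1^2+\sigma_2^2+3\|A\|_2^2R^2+2\sigma_{\max}(C)^2R^2}.$$ In particular the convergence rate is $O(\sqrt{1/n})$: there is a constant $K$ independent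 of $n$ such that, for every $n\ge1$, $\mathrm{Err}(\bar\theta_n,\bar w_n)\le K\sqrt{1/n}$ with probability at least $1-\delta$. -/

import Mathlib

open MeasureTheory ProbabilityTheory
open scoped RealInnerProductSpace

noncomputable section

/-- A finite discounted Markov decision process with deterministic rewards `R(s, a)`. -/
structure FiniteMDP (S A : Type*) where
  transition : S → A → PMF S
  reward : S → A → ℝ
  discount : ℝ
  discount_pos : 0 < discount
  discount_lt_one : discount < 1

/-- The data of distributional policy evaluation with linear function approximation: an MDP,
the policy to be evaluated, the distribution `d` of the first state of a transition, `m` equally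
spaced atoms in `[Vmin, Vmax]`, and the feature map `φ(s, z) ∈ ℝᵏ`. -/
structure LinearDistModel (S A : Type*) (k m : ℕ) extends FiniteMDP S A where
  policy : S → PMF A
  stateDist : PMF S
  Vmin : ℝ
  Vmax : ℝ
  feature : S → ℝ → EuclideanSpace ℝ (Fin k)

namespace LinearDistModel

variable {S A : Type*} {k m : ℕ} (M : LinearDistModel S A k m)

/-- `P^π(s, ·) = ∑ₐ π(s, a) P(· | s, a)`. -/
def policyTransition (s : S) : PMF S := (M.policy s).bind (M.transition s)

/-- `R^π(s) = ∑ₐ π(s, a) R(s, a)`. -/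
def policyReward [Fintype A] (s : S) : ℝ := ∑ a, (M.policy s a).toReal * M.reward s a

/-- The joint law of a random transition `(s, s')`: `s ∼ d` and `s' ∼ P^π(s, ·)`. -/
def transitionLaw : PMF (S × S) :=
  M.stateDist.bind fun s => (M.policyTransition s).map fun s' => (s, s')

/-- The atoms `z_j = Vmin + (j - 1) (Vmax - Vmin) / (m - 1)`, with `j = 1, …, m` written as
`j = 0, …, m - 1`. -/
def atom (j : Fin m) : ℝ := M.Vmin + (j : ℝ) * ((M.Vmax - M.Vmin) / ((m : ℝ) - 1))

/-- The pulled-back atom `(z_j - r) / γ` with `r = R^π(s)`. -/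
def shiftedAtom [Fintype A] (s : S) (j : Fin m) : ℝ :=
  (M.atom j - M.policyReward s) / M.discount

/-- The linear approximation `F_θ(s, z) = φ(s, z)ᵀ θ`. -/
def distFun (θ : EuclideanSpace ℝ (Fin k)) (s : S) (z : ℝ) : ℝ := ⟪M.feature s z, θ⟫

/-- The temporal distribution difference
`δ_θ(s, z_j) = F_θ(s', (z_j - r) / γ) - F_θ(s, z_j)` of the transition `x = (s, s')`. -/
def tdDiff [Fintype A] (θ : EuclideanSpace ℝ (Fin k)) (x : S × S) (j : Fin m) : ℝ :=
  M.distFun θ x.2 (M.shiftedAtom x.1 j) - M.distFun θ x.1 (M.atom j)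

/-- The one-sample matrix `Â = ∑_j φ(s, z_j) (φ(s, z_j) - φ(s', (z_j - r) / γ))ᵀ`. -/
def sampleA [Fintype A] (x : S × S) : Matrix (Fin k) (Fin k) ℝ :=
  ∑ j, Matrix.vecMulVec (M.feature x.1 (M.atom j)).ofLp
    (M.feature x.1 (M.atom j) - M.feature x.2 (M.shiftedAtom x.1 j)).ofLp

/-- The one-sample matrix `Ĉ = ∑_j φ(s, z_j) φ(s, z_j)ᵀ`. -/
def sampleC (x : S × S) : Matrix (Fin k) (Fin k) ℝ :=
  ∑ j, Matrix.vecMulVec (M.feature x.1 (M.atom j)).ofLp (M.feature x.1 (M.atom j)).ofLp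

/-- Expectation of a function of a random transition. -/
def expect [Fintype S] {V : Type*} [AddCommMonoid V] [Module ℝ V] (f : S × S → V) : V :=
  ∑ x, (M.transitionLaw x).toReal • f x

/-- `A = 𝔼 ∑_j φ(s, z_j) (φ(s, z_j) - φ(s', (z_j - r) / γ))ᵀ`. -/
def matA [Fintype S] [Fintype A] : Matrix (Fin k) (Fin k) ℝ := M.expect M.sampleA

/-- `C = 𝔼 ∑_j φ(s, z_j) φ(s, z_j)ᵀ`. -/
def matC [Fintype S] : Matrix (Fin k) (Fin k) ℝ := M.expect M.sampleC

end LinearDistModel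

/-- The action of a square matrix on Euclidean space. -/
abbrev mulE {k : ℕ} (B : Matrix (Fin k) (Fin k) ℝ) (x : EuclideanSpace ℝ (Fin k)) :
    EuclideanSpace ℝ (Fin k) := Matrix.toEuclideanCLM (n := Fin k) (𝕜 := ℝ) B x

/-- The spectral norm `‖B‖₂` (operator norm for the Euclidean norm). -/
def specNorm {k : ℕ} (B : Matrix (Fin k) (Fin k) ℝ) : ℝ :=
  ‖Matrix.toEuclideanCLM (n := Fin k) (𝕜 := ℝ) B‖

/-- The largest singular value of `B`. -/
def sigmaMax {k : ℕ} (B : Matrix (Fin k) (Fin k) ℝ) : ℝ :=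
  (Matrix.toEuclideanLin B).singularValues 0

/-- `L(θ, w) = -⟨A θ, w⟩ - ½ ‖w‖²_C`. -/
def saddleFun {k : ℕ} (A C : Matrix (Fin k) (Fin k) ℝ) (θ w : EuclideanSpace ℝ (Fin k)) : ℝ :=
  -⟪mulE A θ, w⟫ - (1 / 2) * ⟪w, mulE C w⟫

/-- `Err(θ', w') = max_{w ∈ W} L(θ', w) - min_{θ ∈ Θ} L(θ, w')`. -/
def saddleErr {E : Type*} (L : E → E → ℝ) (Θ W : Set E) (θ' w' : E) : ℝ :=
  sSup ((fun w => L θ' w) '' W) - sInf ((fun θ => L θ w') '' Θ)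

/-- `R = max {max_{θ ∈ Θ} ‖θ‖, max_{w ∈ W} ‖w‖}`. -/
def radius {E : Type*} [Norm E] (Θ W : Set E) : ℝ :=
  max (sSup (norm '' Θ)) (sSup (norm '' W))

open Classical in
/-- The metric projection onto `K`: the point of `K` nearest to `x`, which exists and is unique
when `K` is nonempty, closed and convex in Euclidean space (`x` itself if there is none). -/
def metricProj {E : Type*} [Dist E] (K : Set E) (x : E) : E :=
  if h : ∃ y ∈ K, ∀ z ∈ K, dist x y ≤ dist x z then h.choose else x

namespace LinearDistModel

variable {S A : Type*} {k m : ℕ} (M : LinearDistModel S A k m)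

/-- One step of projected distributional GTD2 with step size `a` from `(θ, w)` on the
transition `x = (s, s')`:
`w⁺ = Π_W (w + a ∑_j (-φ(s, z_j)ᵀ w + δ_θ(s, z_j)) φ(s, z_j))` and
`θ⁺ = Π_Θ (θ + a ∑_j (φ(s, z_j) - φ(s', (z_j - r) / γ)) φ(s, z_j)ᵀ w)`. -/
def gtd2Step [Fintype A] (Θ W : Set (EuclideanSpace ℝ (Fin k))) (a : ℝ) (x : S × S)
    (p : EuclideanSpace ℝ (Fin k) × EuclideanSpace ℝ (Fin k)) :
    EuclideanSpace ℝ (Fin k) × EuclideanSpace ℝ (Fin k) :=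
  (metricProj Θ (p.1 + a • ∑ j : Fin m, ⟪M.feature x.1 (M.atom j), p.2⟫ •
      (M.feature x.1 (M.atom j) - M.feature x.2 (M.shiftedAtom x.1 j))),
   metricProj W (p.2 + a • ∑ j : Fin m, (-⟪M.feature x.1 (M.atom j), p.2⟫ + M.tdDiff p.1 x j) •
      M.feature x.1 (M.atom j)))

/-- The iterates `(θ_t, w_t)` with step sizes `α_t`, driven by the transitions `x_t`. -/
def gtd2 {S A : Type*} {k m : ℕ} [Fintype A] (M : LinearDistModel S A k m)
    (Θ W : Set (EuclideanSpace ℝ (Fin k))) (α : ℕ → ℝ) (x : ℕ → S × S)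
    (p₀ : EuclideanSpace ℝ (Fin k) × EuclideanSpace ℝ (Fin k)) :
    ℕ → EuclideanSpace ℝ (Fin k) × EuclideanSpace ℝ (Fin k)
  | 0 => p₀
  | t + 1 => M.gtd2Step Θ W (α t) (x t) (gtd2 M Θ W α x p₀ t)

/-- The output after `n` iterations, `(θ̄_n, w̄_n)` with `θ̄_n = ∑_{t=1}^n α_t θ_t / ∑_{t=1}^n α_t`
and likewise for `w̄_n`. -/
def gtd2Output [Fintype A] (Θ W : Set (EuclideanSpace ℝ (Fin k))) (α : ℕ → ℝ) (x : ℕ → S × S)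
    (p₀ : EuclideanSpace ℝ (Fin k) × EuclideanSpace ℝ (Fin k)) (n : ℕ) :
    EuclideanSpace ℝ (Fin k) × EuclideanSpace ℝ (Fin k) :=
  (∑ t ∈ Finset.Icc 1 n, α t)⁻¹ • ∑ t ∈ Finset.Icc 1 n, α t • M.gtd2 Θ W α x p₀ t

/-- The factor `√(σ₁² + σ₂² + 3 ‖A‖₂² R² + 2 σ_max(C)² R²)`. -/
def gradScale [Fintype S] [Fintype A] (Θ W : Set (EuclideanSpace ℝ (Fin k))) (σ₁ σ₂ : ℝ) : ℝ :=
  √(σ₁ ^ 2 + σ₂ ^ 2 + 3 * specNorm M.matA ^ 2 * radius Θ W ^ 2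
    + 2 * sigmaMax M.matC ^ 2 * radius Θ W ^ 2)

/-- The constant step size `4 R² / (M_* √(5 n))` with `M_* = √2 R · gradScale`, written with one
factor `R` cancelled. -/
def gtd2StepSize [Fintype S] [Fintype A] (Θ W : Set (EuclideanSpace ℝ (Fin k))) (σ₁ σ₂ : ℝ)
    (n : ℕ) : ℝ :=
  4 * radius Θ W / (√(10 * n) * M.gradScale Θ W σ₁ σ₂)

end LinearDistModel

end

noncomputable section

/-! GTD2 is projected stochastic approximation on `Z = Θ × W` for the operator `G = (∂_θ L, -∂_w
L)`. Since `C` is positive semidefinite, `L(θ_t, w) - L(θ, w_t) ≤ ⟪G z_t, z_t - u⟫` for `u = (θ,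
w)`, and Jensen's inequality bounds the gap at the averages by the mean of the right sides
(`saddleErr_average_le`). It remains to bound `∑ a ⟪G z_t, z_t - u⟫` with high probability, for all
`u ∈ Z` at once.

Two devices do this. A ghost iterate `v_t`, driven by the noise alone, splits `⟪ξ, z_t - u⟫` into
`⟪ξ, z_t - v_t⟫`, which does not involve `u`, and `⟪ξ, v_t - u⟫`, which the telescoping of `‖v_t -
u‖²` absorbs. And a logarithmic dependence on `1/δ` is possible under a mere variance bound because
`Z` is bounded: a noise step longer than `√8 R`, a bound for the diameter of `Z`, can cost no more
than the squared diameter. So the noise enters the ghost truncated, and its cost enters as `min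
(a²‖ξ‖²) (8R²)` (`IsProjOn.one_step`). The resulting increments, divided by `8R²`, have exponential
moments controlled by the second moment of `ξ` (`exp_trunc_le`). Independence multiplies these
bounds over time (`integral_prod_le_of_iIndepFun`), and Markov's inequality finishes
(`IsProjOn.sum_inner_le_of_iIndepFun`). -/

/-! ### Scalar and operator-norm estimates -/

/-- The range up to `5/2` is what the truncated increments need: `1` from the inner product and
`3/2` from the capped square. -/
theorem Real.exp_le_one_add_add_two_mul_sq {y : ℝ} (hy : y ≤ 5 / 2) :
    Real.exp y ≤ 1 + y + 2 * y ^ 2 := by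
  rcases le_total y (-1) with h1 | h1
  · have := Real.exp_le_one_iff.2 (by linarith : y ≤ 0)
    nlinarith
  rcases le_total y 1 with h2 | h2
  · have := (abs_le.1 (Real.abs_exp_sub_one_sub_id_le (abs_le.2 ⟨h1, h2⟩))).2
    nlinarith [sq_nonneg y]
  -- On `[1, 5/2]` the exponential lies below its chord; at the endpoints `2.72 < 4` and `14 < 16`
  -- compare with the quadratic.
  have he : Real.exp 1 ≤ 2.72 := Real.exp_one_lt_d9.le.trans (by norm_num)
  have he' : Real.exp (5 / 2) ≤ 14 := by
    refine le_of_sq_le_sq ?_ (by norm_num)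
    calc Real.exp (5 / 2) ^ 2 = Real.exp 1 ^ 5 := by
          rw [← Real.exp_nat_mul, ← Real.exp_nat_mul]; norm_num
      _ ≤ 2.72 ^ 5 := by gcongr
      _ ≤ 14 ^ 2 := by norm_num
  have hc := convexOn_exp.right (Set.mem_univ 1) (Set.mem_univ (5 / 2))
    (show 0 ≤ (5 / 2 - y) / (3 / 2) by linarith) (show 0 ≤ (y - 1) / (3 / 2) by linarith) (by ring)
  simp only [smul_eq_mul] at hc
  rw [show (5 / 2 - y) / (3 / 2) * 1 + (y - 1) / (3 / 2) * (5 / 2) = y by ring] at hc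
  have h3 : (5 / 2 - y) / (3 / 2) * Real.exp 1 ≤ (5 / 2 - y) / (3 / 2) * 2.72 := by gcongr
  have h4 : (y - 1) / (3 / 2) * Real.exp (5 / 2) ≤ (y - 1) / (3 / 2) * 14 := by gcongr
  nlinarith [sq_nonneg (y - 3 / 2)]

/-- In an eigenbasis of `T* T`, `‖T x‖²` is a weighted sum of squared coordinates, and the
eigenvalue of index `0` is the largest weight. -/
theorem LinearMap.norm_apply_le_singularValues_zero_mul {E F : Type*}
    [NormedAddCommGroup E] [InnerProductSpace ℝ E] [FiniteDimensional ℝ E]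
    [NormedAddCommGroup F] [InnerProductSpace ℝ F] [FiniteDimensional ℝ F]
    (T : E →ₗ[ℝ] F) (x : E) : ‖T x‖ ≤ T.singularValues 0 * ‖x‖ := by
  rcases Nat.eq_zero_or_pos (Module.finrank ℝ E) with h0 | hpos
  · have := Module.finrank_zero_iff.1 h0
    simp [Subsingleton.elim x 0]
  refine le_of_sq_le_sq ?_ (mul_nonneg (T.singularValues_nonneg 0) (norm_nonneg x))
  set hT := T.isSymmetric_adjoint_comp_self
  set b := hT.eigenvectorBasis rfl
  have h1 : ‖T x‖ ^ 2 = ∑ i, hT.eigenvalues rfl i * ⟪b i, x⟫ ^ 2 := by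
    rw [← real_inner_self_eq_norm_sq, ← LinearMap.adjoint_inner_left, ← LinearMap.comp_apply,
      ← b.sum_inner_mul_inner]
    refine Finset.sum_congr rfl fun i _ => ?_
    rw [hT x (b i), hT.apply_eigenvectorBasis]
    rw [inner_smul_right, real_inner_comm (b i) x]
    simp only [b, RCLike.ofReal_real_eq_id, _root_.id]
    ring
  rw [h1, mul_pow, ← b.sum_sq_norm_inner_right x, Finset.mul_sum]
  refine Finset.sum_le_sum fun i _ => ?_
  rw [Real.norm_eq_abs, sq_abs, T.sq_singularValues_of_lt rfl hpos]
  gcongr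
  exact hT.eigenvalues_antitone rfl (Fin.mk_le_of_le_val (Nat.zero_le _))

/-! ### Projected steps and truncated noise -/

/-- `P` maps into `Z` and satisfies the variational inequality of the metric projection. -/
structure IsProjOn {H : Type*} [NormedAddCommGroup H] [InnerProductSpace ℝ H]
    (Z : Set H) (P : H → H) : Prop where
  mem : ∀ x, P x ∈ Z
  inner_le : ∀ x, ∀ u ∈ Z, ⟪x - P x, u - P x⟫ ≤ 0

section Projection

variable {H : Type*} [NormedAddCommGroup H] [InnerProductSpace ℝ H]

theorem IsProjOn.norm_sub_sq_le {Z : Set H} {P : H → H} (hP : IsProjOn Z P) (x : H) {u : H}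
    (hu : u ∈ Z) : ‖P x - u‖ ^ 2 ≤ ‖x - u‖ ^ 2 := by
  have h := hP.inner_le x u hu
  have h2 : ‖x - u‖ ^ 2 = ‖x - P x‖ ^ 2 - 2 * ⟪x - P x, u - P x⟫ + ‖u - P x‖ ^ 2 := by
    rw [← norm_sub_sq_real]; congr 2; abel
  rw [norm_sub_rev (P x) u]
  nlinarith [sq_nonneg ‖x - P x‖]

theorem isProjOn_metricProj {K : Set H} (hK : IsCompact K) (hKc : Convex ℝ K)
    (hKn : K.Nonempty) : IsProjOn K (metricProj K) := by
  have key : ∀ x, metricProj K x ∈ K ∧ ∀ z ∈ K, dist x (metricProj K x) ≤ dist x z := by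
    intro x
    have h : ∃ y ∈ K, ∀ z ∈ K, dist x y ≤ dist x z :=
      hK.exists_isMinOn hKn (continuous_const.dist continuous_id).continuousOn
    rw [metricProj, dif_pos h]
    exact h.choose_spec
  refine ⟨fun x => (key x).1, fun x => ?_⟩
  refine (norm_eq_iInf_iff_real_inner_le_zero hKc (key x).1).1 ?_
  have : Nonempty K := hKn.to_subtype
  refine le_antisymm (le_ciInf fun w => ?_)
    (ciInf_le (f := fun w : K => ‖x - w‖) ⟨0, ?_⟩ ⟨_, (key x).1⟩)
  · simpa [dist_eq_norm] using (key x).2 w w.2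
  · rintro _ ⟨w, rfl⟩
    exact norm_nonneg _

open Classical in
/-- The vector `ξ`, replaced by `0` if the step `a • ξ` is longer than `√(8 R²)`. -/
def truncVec (a R : ℝ) (ξ : H) : H := if a ^ 2 * ‖ξ‖ ^ 2 ≤ 8 * R ^ 2 then ξ else 0

/-- The sample is `G - ξ`. For short noise, expand both squares: `z` contributes `a²‖G - ξ‖²/2 ≤
a²(‖G‖² + ‖ξ‖²)` and `v` contributes `a²‖ξ‖²/2`, whence the factor `3/2`. For long noise the ghost
receives no noise, the new `z` is within the diameter of `u`, and Young's inequality handles `G`. -/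
theorem IsProjOn.one_step {Z : Set H} {P : H → H} (hP : IsProjOn Z P) {R : ℝ}
    (hZ : ∀ x ∈ Z, ∀ y ∈ Z, ‖x - y‖ ^ 2 ≤ 8 * R ^ 2) (a : ℝ) {z v u : H} (hz : z ∈ Z)
    (hu : u ∈ Z) (G ξ : H) :
    a * ⟪G, z - u⟫ ≤ (‖z - u‖ ^ 2 / 2 + ‖v - u‖ ^ 2 / 2)
      - (‖P (z - a • (G - ξ)) - u‖ ^ 2 / 2 + ‖P (v - a • truncVec a R ξ) - u‖ ^ 2 / 2)
      + (a * ⟪truncVec a R ξ, z - v⟫ + a ^ 2 * ‖G‖ ^ 2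
        + 3 / 2 * min (a ^ 2 * ‖ξ‖ ^ 2) (8 * R ^ 2)) := by
  have hv := hP.norm_sub_sq_le (v - a • truncVec a R ξ) hu
  unfold truncVec at hv ⊢
  split_ifs at hv ⊢ with h
  · have h1 := hP.norm_sub_sq_le (z - a • (G - ξ)) hu
    rw [sub_right_comm, norm_sub_sq_real (_ - _) (_ • _), inner_smul_right, norm_smul, mul_pow,
      Real.norm_eq_abs, sq_abs] at h1 hv
    have h2 : ‖G - ξ‖ ^ 2 ≤ 2 * ‖G‖ ^ 2 + 2 * ‖ξ‖ ^ 2 := by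
      have := parallelogram_law_with_norm ℝ G ξ
      nlinarith [sq_nonneg ‖G + ξ‖]
    have h3 : ⟪z - u, G - ξ⟫ = ⟪G, z - u⟫ - ⟪ξ, z - u⟫ := by
      rw [real_inner_comm, inner_sub_left]
    have h4 : ⟪ξ, z - v⟫ = ⟪ξ, z - u⟫ - ⟪v - u, ξ⟫ := by
      rw [real_inner_comm ξ (v - u), ← inner_sub_right]; congr 1; abel
    rw [min_eq_left h, h4]
    rw [h3] at h1
    nlinarith [mul_le_mul_of_nonneg_left h2 (sq_nonneg a)]
  · have h1 := hZ _ (hP.mem (z - a • (G - ξ))) u hu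
    have h2 := hZ z hz u hu
    have h3 : 2 * ⟪a • G, z - u⟫ ≤ ‖a • G‖ ^ 2 + ‖z - u‖ ^ 2 := by
      have := norm_sub_sq_real (a • G) (z - u)
      nlinarith [sq_nonneg ‖a • G - (z - u)‖]
    rw [inner_smul_left, norm_smul, mul_pow, Real.norm_eq_abs, sq_abs, conj_trivial] at h3
    rw [min_eq_right (not_le.1 h).le]
    simp only [smul_zero, sub_zero, inner_zero_left, mul_zero, zero_add] at hv ⊢
    nlinarith [sq_nonneg ‖z - u‖]

/-- The right side is affine in the untruncated `⟪ξ, d⟫`, which has mean zero; the bias of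
truncation is paid for by `‖ξ‖²`. The linear and quadratic terms cost `5/16` and `13/8`, together
below `2`. -/
theorem exp_trunc_le {R : ℝ} (hR : 0 < R) (a : ℝ) {d : H} (hd : ‖d‖ ^ 2 ≤ 8 * R ^ 2) (ξ : H) :
    Real.exp ((a * ⟪truncVec a R ξ, d⟫ + 3 / 2 * min (a ^ 2 * ‖ξ‖ ^ 2) (8 * R ^ 2))
      / (8 * R ^ 2)) ≤
    1 + a / (8 * R ^ 2) * ⟪ξ, d⟫ + 2 * (a ^ 2 * ‖ξ‖ ^ 2) / R ^ 2 := by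
  set q := a ^ 2 * ‖ξ‖ ^ 2 with hq
  set i := a * ⟪truncVec a R ξ, d⟫ with hi
  set h := min q (8 * R ^ 2) with hh
  have hq0 : 0 ≤ q := by positivity
  have hR2 : 0 < R ^ 2 := by positivity
  have hh0 : 0 ≤ h := le_min hq0 (by positivity)
  have hhq : h ≤ q := min_le_left _ _
  have hhR : h ≤ 8 * R ^ 2 := min_le_right _ _
  have hcs : (a * ⟪ξ, d⟫) ^ 2 ≤ q * (8 * R ^ 2) := by
    have := sq_le_sq' (neg_le_of_abs_le (abs_real_inner_le_norm ξ d))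
      (le_of_abs_le (abs_real_inner_le_norm ξ d))
    calc (a * ⟪ξ, d⟫) ^ 2 = a ^ 2 * ⟪ξ, d⟫ ^ 2 := by ring
      _ ≤ a ^ 2 * (‖ξ‖ * ‖d‖) ^ 2 := by gcongr
      _ = q * ‖d‖ ^ 2 := by ring
      _ ≤ _ := by gcongr
  -- The second bound is the bias estimate: when truncation acts, `8R² < q`, so Cauchy–Schwarz gives
  -- `|a⟪ξ, d⟫| ≤ q`.
  have hi2 : i ^ 2 ≤ h * (8 * R ^ 2) ∧ i ≤ a * ⟪ξ, d⟫ + q := by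
    by_cases hc : q ≤ 8 * R ^ 2
    · have : i = a * ⟪ξ, d⟫ := by rw [hi, truncVec, if_pos hc]
      rw [this, hh, min_eq_left hc]
      exact ⟨hcs, by linarith⟩
    · have : i = 0 := by rw [hi, truncVec, if_neg hc]; simp
      rw [this]
      refine ⟨by rw [zero_pow two_ne_zero]; positivity, ?_⟩
      have : |a * ⟪ξ, d⟫| ≤ q := abs_le_of_sq_le_sq (by nlinarith) hq0
      linarith [neg_le_of_abs_le this]
  obtain ⟨hi2, hi1⟩ := hi2
  have hi8 : i ≤ 8 * R ^ 2 := le_of_sq_le_sq (by nlinarith) (by positivity)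
  have hy : (i + 3 / 2 * h) / (8 * R ^ 2) ≤ 5 / 2 := by
    rw [div_le_iff₀ (by positivity)]; linarith
  refine (Real.exp_le_one_add_add_two_mul_sq hy).trans ?_
  have e1 : (i + 3 / 2 * h) / (8 * R ^ 2) ≤
      a / (8 * R ^ 2) * ⟪ξ, d⟫ + 5 / 16 * (q / R ^ 2) := by
    rw [div_le_iff₀ (by positivity)]
    field_simp
    linarith
  have e2 : 2 * ((i + 3 / 2 * h) / (8 * R ^ 2)) ^ 2 ≤ 13 / 8 * (q / R ^ 2) := by
    have : (i + 3 / 2 * h) ^ 2 ≤ 52 * (R ^ 2 * q) := by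
      nlinarith [sq_nonneg (i - 3 / 2 * h), mul_le_mul_of_nonneg_left hhq hR2.le,
        mul_le_mul_of_nonneg_left hhR hh0]
    rw [div_pow, mul_div_assoc', mul_div_assoc', div_le_div_iff₀ (by positivity) hR2]
    nlinarith [mul_le_mul_of_nonneg_left this hR2.le]
  have : 0 ≤ q / R ^ 2 := by positivity
  rw [mul_div_assoc]
  linarith

theorem sum_mul_exp_trunc_le {α : Type*} [Fintype α] {p : α → ℝ} (hp : ∀ x, 0 ≤ p x)
    (hp1 : ∑ x, p x = 1) {R : ℝ} (hR : 0 < R) (a : ℝ) {d : H} (hd : ‖d‖ ^ 2 ≤ 8 * R ^ 2)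
    {ξ : α → H} (hξ : ∑ x, p x • ξ x = 0) {s c : ℝ} (hs : ∑ x, p x * ‖ξ x‖ ^ 2 ≤ s)
    {b : ℝ} (hb : b ≤ c) (hc : 0 ≤ c) :
    ∑ x, p x * Real.exp ((a * ⟪truncVec a R (ξ x), d⟫ + a ^ 2 * b
      + 3 / 2 * min (a ^ 2 * ‖ξ x‖ ^ 2) (8 * R ^ 2)) / (8 * R ^ 2)) ≤
    Real.exp (2 * a ^ 2 * (s + c) / R ^ 2) := by
  have hR2 : 0 < R ^ 2 := by positivity
  have key : ∑ x, p x * Real.exp ((a * ⟪truncVec a R (ξ x), d⟫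
      + 3 / 2 * min (a ^ 2 * ‖ξ x‖ ^ 2) (8 * R ^ 2)) / (8 * R ^ 2)) ≤
      Real.exp (2 * a ^ 2 * s / R ^ 2) := by
    calc _ ≤ ∑ x, p x * (1 + a / (8 * R ^ 2) * ⟪ξ x, d⟫ + 2 * (a ^ 2 * ‖ξ x‖ ^ 2) / R ^ 2) :=
          Finset.sum_le_sum fun x _ => mul_le_mul_of_nonneg_left (exp_trunc_le hR a hd _) (hp x)
      _ = ∑ x, p x + a / (8 * R ^ 2) * ⟪∑ x, p x • ξ x, d⟫
          + 2 * a ^ 2 * (∑ x, p x * ‖ξ x‖ ^ 2) / R ^ 2 := by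
        rw [sum_inner, Finset.mul_sum, Finset.mul_sum, Finset.sum_div, ← Finset.sum_add_distrib,
          ← Finset.sum_add_distrib]
        refine Finset.sum_congr rfl fun x _ => ?_
        rw [real_inner_smul_left]
        ring
      _ ≤ 2 * a ^ 2 * s / R ^ 2 + 1 := by
        rw [hp1, hξ, inner_zero_left, mul_zero, add_zero, add_comm]
        gcongr
      _ ≤ _ := Real.add_one_le_exp _
  calc _ = Real.exp (a ^ 2 * b / (8 * R ^ 2)) * ∑ x, p x * Real.exp ((a * ⟪truncVec a R (ξ x), d⟫
      + 3 / 2 * min (a ^ 2 * ‖ξ x‖ ^ 2) (8 * R ^ 2)) / (8 * R ^ 2)) := by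
        rw [Finset.mul_sum]
        refine Finset.sum_congr rfl fun x _ => ?_
        rw [mul_left_comm, ← Real.exp_add]
        congr 2
        ring
    _ ≤ Real.exp (2 * a ^ 2 * c / R ^ 2) * Real.exp (2 * a ^ 2 * s / R ^ 2) := by
        refine mul_le_mul (Real.exp_le_exp.2 ?_) key
          (Finset.sum_nonneg fun x _ => mul_nonneg (hp x) (Real.exp_nonneg _)) (Real.exp_nonneg _)
        rw [div_le_div_iff₀ (by positivity) hR2]
        have := mul_le_mul_of_nonneg_left hb (sq_nonneg a)
        have h0 : 0 ≤ a ^ 2 * c := by positivity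
        have h1 : a ^ 2 * b ≤ 16 * (a ^ 2 * c) := by linarith
        linarith [mul_le_mul_of_nonneg_right h1 hR2.le]
    _ = _ := by rw [← Real.exp_add]; congr 1; ring

end Projection

/-! ### Integrals over independent samples -/

theorem DependsOn.exists_finset_comp {ι α β : Type*} [Nonempty β] {f : (ι → α) → β}
    {s : Finset ι} (hf : DependsOn f (s : Set ι)) :
    ∃ g : (s → α) → β, ∀ x, f x = g fun i => x i := by
  obtain ⟨g, hg⟩ := dependsOn_iff_exists_comp.1 hf
  exact ⟨fun y => g fun i => y ⟨i, i.2⟩, fun x => congrFun hg x⟩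

section Independent

variable {α Ω : Type*} [Fintype α] [MeasurableSpace α] [DiscreteMeasurableSpace α]
  [MeasurableSpace Ω] {μ : Measure Ω}

/-- By independence the joint law is a product, so Fubini integrates out `X` first. This replaces
conditional expectation. -/
theorem integral_mul_le_of_indepFun [IsProbabilityMeasure μ] {β : Type*} [Finite β]
    [MeasurableSpace β] [DiscreteMeasurableSpace β] {Y : Ω → β} {X : Ω → α}
    (hY : Measurable Y) (hX : Measurable X) (hYX : IndepFun Y X μ) {p : PMF α}
    (hp : μ.map X = p.toMeasure) {F : β → ℝ} (hF : ∀ y, 0 ≤ F y) {c : β → α → ℝ} {κ : ℝ}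
    (hc : ∀ y, ∑ x, (p x).toReal * c y x ≤ κ) :
    ∫ ω, F (Y ω) * c (Y ω) (X ω) ∂μ ≤ κ * ∫ ω, F (Y ω) ∂μ := by
  have : IsProbabilityMeasure (μ.map Y) := Measure.isProbabilityMeasure_map hY.aemeasurable
  have h1 : ∫ ω, F (Y ω) * c (Y ω) (X ω) ∂μ =
      ∫ q : β × α, F q.1 * c q.1 q.2 ∂(μ.map Y).prod (p.toMeasure) := by
    rw [← hp, ← hYX.map_prod_eq_prod_map_map hY.aemeasurable hX.aemeasurable,
      integral_map (hY.prodMk hX).aemeasurable]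
    exact (Measurable.of_discrete).aestronglyMeasurable
  have h2 : ∫ ω, F (Y ω) ∂μ = ∫ y, F y ∂(μ.map Y) :=
    (integral_map hY.aemeasurable (Measurable.of_discrete).aestronglyMeasurable).symm
  rw [h1, h2, integral_prod _ Integrable.of_finite, ← integral_const_mul]
  refine integral_mono Integrable.of_finite Integrable.of_finite fun y => ?_
  simp only [integral_const_mul]
  rw [PMF.integral_eq_sum, mul_comm κ]
  exact mul_le_mul_of_nonneg_left (hc y) (hF y)

variable {X : ℕ → Ω → α} (hXm : ∀ t, Measurable (X t))
include hXm

theorem DependsOn.measurable_comp {f : (ℕ → α) → ℝ} {s : Finset ℕ}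
    (hf : DependsOn f (s : Set ℕ)) : Measurable fun ω => f fun t => X t ω := by
  obtain ⟨g, hg⟩ := hf.exists_finset_comp
  simp only [hg]
  exact (Measurable.of_discrete (f := g)).comp (measurable_pi_lambda _ fun i => hXm i)

theorem DependsOn.integrable_comp [IsProbabilityMeasure μ] {f : (ℕ → α) → ℝ} {s : Finset ℕ}
    (hf : DependsOn f (s : Set ℕ)) : Integrable (fun ω => f fun t => X t ω) μ := by
  obtain ⟨g, hg⟩ := hf.exists_finset_comp
  simp only [hg]
  have hm : Measurable fun ω (i : s) => X i ω := measurable_pi_lambda _ fun i => hXm i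
  have := Measure.isProbabilityMeasure_map (μ := μ) hm.aemeasurable
  exact (Integrable.of_finite (μ := μ.map _) (f := g)).comp_measurable hm

/-- A supermartingale bound by induction: the last factor is integrated over the fresh sample `X (n
+ 1)`, while everything else depends on times up to `n`. -/
theorem integral_prod_le_of_iIndepFun [IsProbabilityMeasure μ] {p : PMF α}
    (hXlaw : ∀ t, μ.map (X t) = p.toMeasure) (hXindep : iIndepFun X μ)
    {c : ℕ → (ℕ → α) → α → ℝ} (hdep : ∀ t a, DependsOn (fun x => c t x a) (Finset.Iic t : Set ℕ))
    (hc0 : ∀ t x a, 0 ≤ c t x a) {κ : ℝ} (hκ : 0 ≤ κ)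
    (hc : ∀ t x, ∑ a, (p a).toReal * c t x a ≤ κ) (n : ℕ) :
    ∫ ω, ∏ t ∈ Finset.range n, c t (fun s => X s ω) (X (t + 1) ω) ∂μ ≤ κ ^ n := by
  have hα : Nonempty α := ⟨p.support_nonempty.some⟩
  induction n with
  | zero => simp
  | succ n ih =>
    set f : (ℕ → α) → ℝ := fun x => ∏ t ∈ Finset.range n, c t x (x (t + 1)) with hf
    have hfd : DependsOn f (Finset.Iic n : Set ℕ) := by
      intro x y hxy
      refine Finset.prod_congr rfl fun t ht => ?_
      have ht := Finset.mem_range.1 ht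
      rw [hxy (t + 1) (by simp; omega)]
      exact hdep t _ fun i hi => hxy i (by simp at hi ⊢; omega)
    obtain ⟨F, hF⟩ := hfd.exists_finset_comp
    choose g hg using fun a => (hdep n a).exists_finset_comp
    -- Every finite history extends to a full sequence, so the hypotheses on `c` pass to its
    -- factorization through the history.
    have hext : ∀ y : (Finset.Iic n) → α, ∃ x : ℕ → α, y = fun i : Finset.Iic n => x i := fun y =>
      ⟨fun i => if h : i ∈ Finset.Iic n then y ⟨i, h⟩ else hα.some, by
        funext i; dsimp only; rw [dif_pos i.2]⟩
    have hind : IndepFun (fun ω (i : Finset.Iic n) => X i ω) (X (n + 1)) μ := by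
      have h := hXindep.indepFun_finset (Finset.Iic n) {n + 1} (by simp) hXm
      exact h.comp measurable_id (measurable_pi_apply (⟨n + 1, by simp⟩ : ({n + 1} : Finset ℕ)))
    have := integral_mul_le_of_indepFun (Y := fun ω (i : Finset.Iic n) => X i ω)
      (measurable_pi_lambda _ fun i => hXm i) (hXm (n + 1)) hind (hXlaw (n + 1)) (F := F) (c := fun y a => g a y) (κ := κ)
      (fun y => by
        obtain ⟨x, rfl⟩ := hext y
        rw [← hF]
        exact Finset.prod_nonneg fun t _ => hc0 _ _ _)
      (fun y => by
        obtain ⟨x, rfl⟩ := hext y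
        exact (Finset.sum_congr rfl fun b _ => by rw [hg]).trans_le (hc n x))
    have eF : ∀ ω, F (fun i => X i ω) = f fun s => X s ω := fun ω =>
      (hF fun s => X s ω).symm
    have eg : ∀ ω b, g b (fun i => X i ω) = c n (fun s => X s ω) b := fun ω b =>
      (hg b fun s => X s ω).symm
    simp only [eF, eg] at this
    simp only [Finset.prod_range_succ]
    calc _ ≤ κ * ∫ ω, f fun s => X s ω ∂μ := this
      _ ≤ κ * κ ^ n := mul_le_mul_of_nonneg_left ih hκ
      _ = _ := by ring

end Independent

/-! ### The high probability bound -/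

/-- The trajectory of the recursion `q_{t+1} = f (q_t, x_t)`. -/
def drivenIter {Q α : Type*} (f : Q → α → Q) (q₀ : Q) (x : ℕ → α) : ℕ → Q
  | 0 => q₀
  | t + 1 => f (drivenIter f q₀ x t) (x t)

theorem dependsOn_drivenIter {Q α : Type*} (f : Q → α → Q) (q₀ : Q) (t : ℕ) :
    DependsOn (fun x => drivenIter f q₀ x t) (Set.Iio t) := by
  induction t with
  | zero => intro x y _; rfl
  | succ t ih =>
    intro x y h
    simp only [drivenIter]
    have e : drivenIter f q₀ x t = drivenIter f q₀ y t :=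
      ih fun i hi => h i (lt_trans hi t.lt_succ_self)
    rw [e, h t t.lt_succ_self]

/-- Projected stochastic approximation for a bounded monotone operator `G` with unbiased
finite-variance samples `g x`: a high probability bound on the accumulated gap. -/
theorem IsProjOn.sum_inner_le_of_iIndepFun {H α Ω : Type*} [NormedAddCommGroup H]
    [InnerProductSpace ℝ H] [Fintype α] [MeasurableSpace α] [DiscreteMeasurableSpace α]
    [MeasurableSpace Ω] {μ : Measure Ω} [IsProbabilityMeasure μ]
    {Z : Set H} {P : H → H} (hP : IsProjOn Z P) {R : ℝ} (hR : 0 < R)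
    (hZ : ∀ x ∈ Z, ∀ y ∈ Z, ‖x - y‖ ^ 2 ≤ 8 * R ^ 2) {p : PMF α} {g : α → H → H} {G : H → H}
    (hG : ∀ z ∈ Z, ∑ x, (p x).toReal • g x z = G z) {s c : ℝ}
    (hs : ∀ z ∈ Z, ∑ x, (p x).toReal * ‖g x z - G z‖ ^ 2 ≤ s) (hc0 : 0 ≤ c)
    (hc : ∀ z ∈ Z, ‖G z‖ ^ 2 ≤ c) {a : ℝ} {n : ℕ}
    (ha : a ^ 2 * n * (s + c) ≤ 8 / 5 * R ^ 2)
    {X : ℕ → Ω → α} (hXm : ∀ t, Measurable (X t)) (hXlaw : ∀ t, μ.map (X t) = p.toMeasure)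
    (hXindep : iIndepFun X μ) (z₀ : H) {δ : ℝ} (hδ : 0 < δ) :
    1 - δ ≤ μ.real {ω | ∀ u ∈ Z, ∑ t ∈ Finset.range n,
      a * ⟪G (drivenIter (fun z x => P (z - a • g x z)) z₀ (fun t => X t ω) (t + 1)),
        drivenIter (fun z x => P (z - a • g x z)) z₀ (fun t => X t ω) (t + 1) - u⟫ ≤
      (32 + 8 * Real.log (2 / δ)) * R ^ 2} := by
  have hR2 : 0 < R ^ 2 := by positivity
  have hp1 : ∑ x, (p x).toReal = 1 := by
    rw [← ENNReal.toReal_sum fun x _ => p.apply_ne_top x, ← tsum_fintype (L := .unconditional _),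
      p.tsum_coe, ENNReal.toReal_one]
  -- Iterate and ghost run as one recursion. Both start at `z₀`, possibly outside `Z`, so membership
  -- is claimed only from index `1` on.
  set f : H × H → α → H × H := fun q x =>
    (P (q.1 - a • g x q.1), P (q.2 - a • truncVec a R (G q.1 - g x q.1))) with hf
  set z : (ℕ → α) → ℕ → H := fun x t => drivenIter (fun z x => P (z - a • g x z)) z₀ x t with hz
  set q : (ℕ → α) → ℕ → H × H := fun x t => drivenIter f (z₀, z₀) x t with hq
  have hqz : ∀ x t, (q x t).1 = z x t := by
    intro x t
    induction t with
    | zero => rfl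
    | succ t ih => simp only [hq, hz, drivenIter, hf] at ih ⊢; rw [ih]
  have hqmem : ∀ x t, (q x (t + 1)).1 ∈ Z ∧ (q x (t + 1)).2 ∈ Z := fun x t =>
    ⟨hP.mem _, hP.mem _⟩
  set E : H × H → α → ℝ := fun q x =>
    (a * ⟪truncVec a R (G q.1 - g x q.1), q.1 - q.2⟫ + a ^ 2 * ‖G q.1‖ ^ 2
        + 3 / 2 * min (a ^ 2 * ‖G q.1 - g x q.1‖ ^ 2) (8 * R ^ 2)) / (8 * R ^ 2) with hE
  set T : (ℕ → α) → ℝ := fun x => ∑ t ∈ Finset.range n, E (q x (t + 1)) (x (t + 1)) with hT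
  have hstep : ∀ x, ∀ u ∈ Z, ∑ t ∈ Finset.range n, a * ⟪G (z x (t + 1)), z x (t + 1) - u⟫ ≤
      8 * R ^ 2 + 8 * R ^ 2 * T x := by
    intro x u hu
    -- Telescoping potential; `Φ 0 ≤ 8R²` by the diameter bound applied to both halves.
    set Φ : ℕ → ℝ := fun t => ‖(q x (t + 1)).1 - u‖ ^ 2 / 2 + ‖(q x (t + 1)).2 - u‖ ^ 2 / 2
    have h1 : ∀ t, a * ⟪G (z x (t + 1)), z x (t + 1) - u⟫ ≤
        (Φ t - Φ (t + 1)) + 8 * R ^ 2 * E (q x (t + 1)) (x (t + 1)) := by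
      intro t
      have := hP.one_step hZ a (v := (q x (t + 1)).2) (hqmem x t).1 hu (G (q x (t + 1)).1)
        (G (q x (t + 1)).1 - g (x (t + 1)) (q x (t + 1)).1)
      rw [sub_sub_cancel] at this
      rw [← hqz, hE, mul_div_cancel₀ _ (by positivity)]
      exact this
    calc _ ≤ ∑ t ∈ Finset.range n,
          ((Φ t - Φ (t + 1)) + 8 * R ^ 2 * E (q x (t + 1)) (x (t + 1))) :=
          Finset.sum_le_sum fun t _ => h1 t
      _ = Φ 0 - Φ n + 8 * R ^ 2 * T x := by
        rw [Finset.sum_add_distrib, Finset.sum_range_sub', Finset.mul_sum]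
      _ ≤ _ := by
        have h2 := hZ _ (hqmem x 0).1 u hu
        have h3 := hZ _ (hqmem x 0).2 u hu
        have h4 : 0 ≤ Φ n := by positivity
        have h5 : Φ 0 = ‖(q x (0 + 1)).1 - u‖ ^ 2 / 2 + ‖(q x (0 + 1)).2 - u‖ ^ 2 / 2 := rfl
        linarith
  have hqdep : ∀ t x y, (∀ i ∈ (Finset.Iic t : Set ℕ), x i = y i) →
      q x (t + 1) = q y (t + 1) := fun t x y h =>
    dependsOn_drivenIter f (z₀, z₀) (t + 1) fun i hi => h i (by
      simpa using Nat.lt_succ_iff.1 (Set.mem_Iio.1 hi))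
  have hmgf : ∫ ω, Real.exp (T fun t => X t ω) ∂μ ≤ Real.exp (16 / 5) := by
    simp only [hT, Real.exp_sum]
    refine (integral_prod_le_of_iIndepFun hXm hXlaw hXindep
      (c := fun t x b => Real.exp (E (q x (t + 1)) b)) (fun t b x y h => ?_)
      (fun _ _ _ => Real.exp_nonneg _) (Real.exp_nonneg (2 * a ^ 2 * (s + c) / R ^ 2))
      (fun t x => ?_) n).trans ?_
    · simp only
      rw [hqdep t x y h]
    · obtain ⟨h1, h2⟩ := hqmem x t
      refine sum_mul_exp_trunc_le (fun x => ENNReal.toReal_nonneg) hp1 hR a (hZ _ h1 _ h2) ?_ ?_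
        (hc _ h1) hc0
      · simp only [smul_sub, Finset.sum_sub_distrib, ← Finset.sum_smul, hp1, one_smul, hG _ h1,
          sub_self]
      · simpa only [norm_sub_rev] using hs _ h1
    · rw [← Real.exp_nat_mul]
      refine Real.exp_le_exp.2 ?_
      rw [mul_div_assoc', div_le_iff₀ hR2]
      linarith
  -- The one-step inequality at `z_n` uses the sample `X n`, one beyond those that determine the
  -- iterates `z_1, …, z_n`.
  have hTdep : DependsOn T (Finset.Iic n : Set ℕ) := by
    intro x y h
    refine Finset.sum_congr rfl fun t ht => ?_
    have ht := Finset.mem_range.1 ht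
    rw [hqdep t x y fun i hi => h i (by simp at hi ⊢; omega), h (t + 1) (by simp; omega)]
  have hTm : Measurable fun ω => T fun t => X t ω := hTdep.measurable_comp hXm
  have hint : Integrable (fun ω => Real.exp (T fun t => X t ω)) μ :=
    DependsOn.integrable_comp hXm (f := fun x => Real.exp (T x)) (s := Finset.Iic n)
      fun x y h => congrArg Real.exp (hTdep h)
  -- Since `exp (16/5) ≤ 2 exp 3`, the threshold `3 + ℓ` is exceeded with probability at most `δ`;
  -- off that event the total is below `8R²(1 + 3 + ℓ)`.
  set ℓ := Real.log (2 / δ) with hℓ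
  have hmarkov := mul_meas_ge_le_integral_of_nonneg
    (ae_of_all μ fun ω => (Real.exp_nonneg (T fun t => X t ω))) hint (Real.exp (3 + ℓ))
  have hbad : μ.real {ω | Real.exp (3 + ℓ) ≤ Real.exp (T fun t => X t ω)} ≤ δ := by
    have h1 : Real.exp (3 + ℓ) = Real.exp 3 * (2 / δ) := by
      rw [Real.exp_add, hℓ, Real.exp_log (by positivity)]
    have h2 : Real.exp (16 / 5) ≤ Real.exp 3 * 2 := by
      rw [show (16 / 5 : ℝ) = 3 + 1 / 5 by norm_num, Real.exp_add]
      gcongr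
      have := (abs_le.1 (Real.abs_exp_sub_one_sub_id_le (x := 1 / 5) (by norm_num [abs_le]))).2
      norm_num at this ⊢
      linarith
    have h3 := (hmarkov.trans hmgf).trans h2
    have h4 : Real.exp (3 + ℓ) * μ.real {ω | Real.exp (3 + ℓ) ≤ Real.exp (T fun t => X t ω)} ≤
      Real.exp (3 + ℓ) * δ := by
      refine h3.trans (le_of_eq ?_)
      rw [h1]; field_simp
    exact le_of_mul_le_mul_left h4 (Real.exp_pos _)
  have hmeas : MeasurableSet {ω | Real.exp (3 + ℓ) ≤ Real.exp (T fun t => X t ω)} :=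
    measurableSet_le measurable_const hTm.exp
  have hcompl := probReal_compl_eq_one_sub (μ := μ) hmeas
  refine (by linarith : 1 - δ ≤ μ.real {ω | Real.exp (3 + ℓ) ≤ Real.exp (T fun t => X t ω)}ᶜ).trans
    (measureReal_mono fun ω hω u hu => ?_)
  have hω' : T (fun t => X t ω) < 3 + ℓ := by
    simpa only [Set.mem_compl_iff, Set.mem_ofPred_eq, not_le, Real.exp_lt_exp] using hω
  refine (hstep _ u hu).trans ?_
  nlinarith

/-! ### Product domains, the saddle operator and the gap -/

theorem IsProjOn.prod {E F : Type*} [NormedAddCommGroup E] [InnerProductSpace ℝ E]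
    [NormedAddCommGroup F] [InnerProductSpace ℝ F] {K : Set E} {L : Set F} {P : E → E} {Q : F → F}
    (hP : IsProjOn K P) (hQ : IsProjOn L Q) :
    IsProjOn {z : WithLp 2 (E × F) | z.fst ∈ K ∧ z.snd ∈ L}
      (fun z => WithLp.toLp 2 (P z.fst, Q z.snd)) where
  mem z := ⟨hP.mem _, hQ.mem _⟩
  inner_le z u hu := by
    rw [WithLp.prod_inner_apply]
    exact add_nonpos (hP.inner_le _ _ hu.1) (hQ.inner_le _ _ hu.2)

theorem norm_le_radius {E : Type*} [SeminormedAddCommGroup E] {Θ W : Set E} (hΘ : IsCompact Θ)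
    (hW : IsCompact W) {x : E} (hx : x ∈ Θ ∨ x ∈ W) : ‖x‖ ≤ radius Θ W := by
  rcases hx with hx | hx
  · exact (le_csSup (hΘ.image continuous_norm).bddAbove ⟨x, hx, rfl⟩).trans (le_max_left _ _)
  · exact (le_csSup (hW.image continuous_norm).bddAbove ⟨x, hx, rfl⟩).trans (le_max_right _ _)

theorem saddleErr_le {E : Type*} {L : E → E → ℝ} {Θ W : Set E} (hΘ : Θ.Nonempty)
    (hW : W.Nonempty) {θ' w' : E} {B : ℝ} (h : ∀ θ ∈ Θ, ∀ w ∈ W, L θ' w - L θ w' ≤ B) :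
    saddleErr L Θ W θ' w' ≤ B := by
  rw [saddleErr, sub_le_iff_le_add]
  refine csSup_le (hW.image _) ?_
  rintro _ ⟨w, hw, rfl⟩
  rw [← sub_le_iff_le_add']
  refine le_csInf (hΘ.image _) ?_
  rintro _ ⟨θ, hθ, rfl⟩
  linarith [h θ hθ w hw]

section Matrices

variable {k : ℕ}

theorem mulE_sum {ι : Type*} (s : Finset ι) (B : ι → Matrix (Fin k) (Fin k) ℝ)
    (x : EuclideanSpace ℝ (Fin k)) : mulE (∑ i ∈ s, B i) x = ∑ i ∈ s, mulE (B i) x := by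
  simp only [mulE, map_sum, _root_.sum_apply]

theorem mulE_smul (c : ℝ) (B : Matrix (Fin k) (Fin k) ℝ) (x : EuclideanSpace ℝ (Fin k)) :
    mulE (c • B) x = c • mulE B x := by
  simp only [mulE, map_smul, _root_.smul_apply]

theorem mulE_sub (B : Matrix (Fin k) (Fin k) ℝ) (x y : EuclideanSpace ℝ (Fin k)) :
    mulE B (x - y) = mulE B x - mulE B y := map_sub _ _ _

theorem mulE_vecMulVec (u v x : EuclideanSpace ℝ (Fin k)) :
    mulE (Matrix.vecMulVec u.ofLp v.ofLp) x = ⟪v, x⟫ • u := by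
  ext i
  simp only [mulE, Matrix.ofLp_toEuclideanCLM, Matrix.vecMulVec_mulVec, PiLp.smul_apply,
    PiLp.inner_apply, dotProduct]
  simp [mul_comm]

theorem inner_mulE_transpose (B : Matrix (Fin k) (Fin k) ℝ) (x y : EuclideanSpace ℝ (Fin k)) :
    ⟪mulE B.transpose x, y⟫ = ⟪x, mulE B y⟫ := by
  have : B.transpose = star B := by
    rw [Matrix.star_eq_conjTranspose, Matrix.conjTranspose_eq_transpose_of_trivial]
  rw [mulE, this, map_star, ContinuousLinearMap.star_eq_adjoint,
    ContinuousLinearMap.adjoint_inner_left]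

theorem norm_mulE_le (B : Matrix (Fin k) (Fin k) ℝ) (x : EuclideanSpace ℝ (Fin k)) :
    ‖mulE B x‖ ≤ specNorm B * ‖x‖ :=
  ContinuousLinearMap.le_opNorm _ _

theorem norm_mulE_transpose_le (B : Matrix (Fin k) (Fin k) ℝ) (x : EuclideanSpace ℝ (Fin k)) :
    ‖mulE B.transpose x‖ ≤ specNorm B * ‖x‖ := by
  have : B.transpose = star B := by
    rw [Matrix.star_eq_conjTranspose, Matrix.conjTranspose_eq_transpose_of_trivial]
  rw [mulE, this, map_star, specNorm, ← norm_star (Matrix.toEuclideanCLM (n := Fin k) (𝕜 := ℝ) B)]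
  exact ContinuousLinearMap.le_opNorm _ _

theorem norm_mulE_le_sigmaMax (B : Matrix (Fin k) (Fin k) ℝ) (x : EuclideanSpace ℝ (Fin k)) :
    ‖mulE B x‖ ≤ sigmaMax B * ‖x‖ :=
  LinearMap.norm_apply_le_singularValues_zero_mul (Matrix.toEuclideanLin B) x

/-- The monotone operator `(∂_θ L, -∂_w L)` of the saddle function of `A` and `C`. -/
def saddleOp (A C : Matrix (Fin k) (Fin k) ℝ)
    (z : WithLp 2 (EuclideanSpace ℝ (Fin k) × EuclideanSpace ℝ (Fin k))) :
    WithLp 2 (EuclideanSpace ℝ (Fin k) × EuclideanSpace ℝ (Fin k)) :=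
  WithLp.toLp 2 (-mulE A.transpose z.snd, mulE A z.fst + mulE C z.snd)

variable {A C : Matrix (Fin k) (Fin k) ℝ}

/-- One `‖A‖₂²R²` comes from `Aᵀw`; the others come from `‖Aθ + Cw‖² ≤ 2‖Aθ‖² + 2‖Cw‖²`. -/
theorem norm_saddleOp_sq_le {R : ℝ}
    {z : WithLp 2 (EuclideanSpace ℝ (Fin k) × EuclideanSpace ℝ (Fin k))}
    (h1 : ‖z.fst‖ ≤ R) (h2 : ‖z.snd‖ ≤ R) :
    ‖saddleOp A C z‖ ^ 2 ≤ 3 * specNorm A ^ 2 * R ^ 2 + 2 * sigmaMax C ^ 2 * R ^ 2 := by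
  have hA : 0 ≤ specNorm A := norm_nonneg _
  have hC : 0 ≤ sigmaMax C := LinearMap.singularValues_nonneg _ _
  have e1 : ‖mulE A.transpose z.snd‖ ≤ specNorm A * R :=
    (norm_mulE_transpose_le A _).trans (by gcongr)
  have e2 : ‖mulE A z.fst‖ ≤ specNorm A * R := (norm_mulE_le A _).trans (by gcongr)
  have e3 : ‖mulE C z.snd‖ ≤ sigmaMax C * R := (norm_mulE_le_sigmaMax C _).trans (by gcongr)
  have e4 := norm_add_le (mulE A z.fst) (mulE C z.snd)
  rw [WithLp.prod_norm_sq_eq_of_L2]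
  simp only [saddleOp, WithLp.toLp_fst, WithLp.toLp_snd, norm_neg]
  have f1 := pow_le_pow_left₀ (norm_nonneg _) e1 2
  have f2 := pow_le_pow_left₀ (norm_nonneg _) e2 2
  have f3 := pow_le_pow_left₀ (norm_nonneg _) e3 2
  have f4 := pow_le_pow_left₀ (norm_nonneg _) e4 2
  nlinarith [sq_nonneg (‖mulE A z.fst‖ - ‖mulE C z.snd‖)]

variable (hsymm : ∀ x y, ⟪x, mulE C y⟫ = ⟪y, mulE C x⟫) (hpos : ∀ x, 0 ≤ ⟪x, mulE C x⟫)

include hsymm hpos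

/-- The two sides differ by exactly half the `C`-quadratic form at `z.snd - u.snd`; the `A`-terms
cancel. -/
theorem saddleFun_sub_le (z u : WithLp 2 (EuclideanSpace ℝ (Fin k) × EuclideanSpace ℝ (Fin k))) :
    saddleFun A C z.fst u.snd - saddleFun A C u.fst z.snd ≤ ⟪saddleOp A C z, z - u⟫ := by
  have h := hpos (z.snd - u.snd)
  have hs := hsymm u.snd z.snd
  rw [WithLp.prod_inner_apply]
  change _ ≤ ⟪-mulE A.transpose z.snd, z.fst - u.fst⟫
    + ⟪mulE A z.fst + mulE C z.snd, z.snd - u.snd⟫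
  rw [inner_neg_left, inner_mulE_transpose, mulE_sub, real_inner_comm (z.snd - u.snd)]
  simp only [saddleFun, inner_add_right, inner_sub_left, inner_sub_right, mulE_sub,
    real_inner_comm z.snd (mulE A _), real_inner_comm u.snd (mulE A _)] at h ⊢
  linarith

theorem convexOn_saddleFun_sub (θ w : EuclideanSpace ℝ (Fin k)) :
    ConvexOn ℝ Set.univ
      (fun z : EuclideanSpace ℝ (Fin k) × EuclideanSpace ℝ (Fin k) =>
        saddleFun A C z.1 w - saddleFun A C θ z.2) := by
  refine ⟨convex_univ, fun x _ y _ a b ha hb hab => ?_⟩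
  obtain rfl : b = 1 - a := by linarith
  have h := mul_nonneg (mul_nonneg ha hb) (hpos (x.2 - y.2))
  have hs := hsymm y.2 x.2
  simp only [saddleFun, Prod.fst_add, Prod.snd_add, Prod.smul_fst, Prod.smul_snd, map_add, map_sub,
    map_smul, inner_add_left, inner_add_right, inner_sub_left, inner_sub_right,
    real_inner_smul_left, real_inner_smul_right, smul_eq_mul, hs] at h ⊢
  nlinarith

/-- Jensen moves the averages outside the gap function at each fixed `(θ, w)`; the bound is uniform
in `u`, so supremum and infimum can be taken afterwards. -/
theorem saddleErr_average_le {Θ W : Set (EuclideanSpace ℝ (Fin k))} (hΘ : Θ.Nonempty)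
    (hW : W.Nonempty) {n : ℕ} (hn : 0 < n) {a : ℝ} (ha : 0 < a) {B : ℝ}
    {z : ℕ → WithLp 2 (EuclideanSpace ℝ (Fin k) × EuclideanSpace ℝ (Fin k))}
    (h : ∀ u ∈ {z : WithLp 2 (EuclideanSpace ℝ (Fin k) × EuclideanSpace ℝ (Fin k)) |
      z.fst ∈ Θ ∧ z.snd ∈ W}, ∑ t ∈ Finset.range n, a * ⟪saddleOp A C (z t), z t - u⟫ ≤ B) :
    saddleErr (saddleFun A C) Θ W ((n : ℝ)⁻¹ • ∑ t ∈ Finset.range n, (z t).ofLp).1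
      ((n : ℝ)⁻¹ • ∑ t ∈ Finset.range n, (z t).ofLp).2 ≤ B / (n * a) := by
  have hn' : (0 : ℝ) < n := by exact_mod_cast hn
  refine saddleErr_le hΘ hW fun θ hθ w hw => ?_
  have hc := (convexOn_saddleFun_sub (A := A) hsymm hpos θ w).map_sum_le
    (t := Finset.range n) (w := fun _ => (n : ℝ)⁻¹) (p := fun t => (z t).ofLp)
    (fun _ _ => by positivity) (by simp [hn'.ne']) (fun _ _ => Set.mem_univ _)
  rw [← Finset.smul_sum, ← Finset.smul_sum, smul_eq_mul] at hc
  refine hc.trans ?_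
  have hB := h (WithLp.toLp 2 (θ, w)) ⟨hθ, hw⟩
  rw [← Finset.mul_sum] at hB
  rw [le_div_iff₀ (by positivity)]
  refine le_trans ?_ hB
  rw [show ∀ x : ℝ, (n : ℝ)⁻¹ * x * (n * a) = a * x from fun x => by field_simp]
  gcongr with t
  exact saddleFun_sub_le hsymm hpos (z t) (WithLp.toLp 2 (θ, w))

end Matrices

/-! ### GTD2 as projected stochastic approximation -/

namespace LinearDistModel

variable {S A : Type*} {k m : ℕ} (M : LinearDistModel S A k m)

theorem mulE_expect [Fintype S] (f : S × S → Matrix (Fin k) (Fin k) ℝ)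
    (x : EuclideanSpace ℝ (Fin k)) : mulE (M.expect f) x = M.expect fun y => mulE (f y) x := by
  simp only [expect, mulE_sum, mulE_smul]

theorem transpose_expect [Fintype S] (f : S × S → Matrix (Fin k) (Fin k) ℝ) :
    (M.expect f).transpose = M.expect fun y => (f y).transpose := by
  simp only [expect, Matrix.transpose_sum, Matrix.transpose_smul]

theorem mulE_sampleC (x : S × S) (w : EuclideanSpace ℝ (Fin k)) :
    mulE (M.sampleC x) w =
      ∑ j, ⟪M.feature x.1 (M.atom j), w⟫ • M.feature x.1 (M.atom j) := by
  simp only [sampleC, mulE_sum, mulE_vecMulVec]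

theorem inner_mulE_matC [Fintype S] (v w : EuclideanSpace ℝ (Fin k)) :
    ⟪v, mulE M.matC w⟫ = ∑ x, (M.transitionLaw x).toReal *
      ∑ j, ⟪M.feature x.1 (M.atom j), w⟫ * ⟪M.feature x.1 (M.atom j), v⟫ := by
  rw [matC, mulE_expect]
  simp only [expect, inner_sum, real_inner_smul_right, mulE_sampleC]
  simp only [real_inner_comm v]

theorem inner_mulE_matC_comm [Fintype S] (v w : EuclideanSpace ℝ (Fin k)) :
    ⟪v, mulE M.matC w⟫ = ⟪w, mulE M.matC v⟫ := by
  simp only [inner_mulE_matC, mul_comm ⟪_, v⟫]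

theorem inner_mulE_matC_self_nonneg [Fintype S] (w : EuclideanSpace ℝ (Fin k)) :
    0 ≤ ⟪w, mulE M.matC w⟫ := by
  rw [inner_mulE_matC]
  exact Finset.sum_nonneg fun x _ => mul_nonneg ENNReal.toReal_nonneg
    (Finset.sum_nonneg fun j _ => mul_self_nonneg _)

variable [Fintype A]

theorem mulE_sampleA (x : S × S) (θ : EuclideanSpace ℝ (Fin k)) :
    mulE (M.sampleA x) θ = ∑ j, ⟪M.feature x.1 (M.atom j) -
      M.feature x.2 (M.shiftedAtom x.1 j), θ⟫ • M.feature x.1 (M.atom j) := by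
  simp only [sampleA, mulE_sum, mulE_vecMulVec]

theorem mulE_transpose_sampleA (x : S × S) (w : EuclideanSpace ℝ (Fin k)) :
    mulE (M.sampleA x).transpose w = ∑ j, ⟪M.feature x.1 (M.atom j), w⟫ •
      (M.feature x.1 (M.atom j) - M.feature x.2 (M.shiftedAtom x.1 j)) := by
  simp only [sampleA, Matrix.transpose_sum, Matrix.transpose_vecMulVec, mulE_sum, mulE_vecMulVec]

/-- Identifies the GTD2 update as a descent step along the saddle operator of the sampled matrices,
both components being evaluated at the old iterate. -/
theorem gtd2Step_eq (Θ W : Set (EuclideanSpace ℝ (Fin k))) (a : ℝ) (x : S × S)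
    (z : WithLp 2 (EuclideanSpace ℝ (Fin k) × EuclideanSpace ℝ (Fin k))) :
    M.gtd2Step Θ W a x z.ofLp =
      (metricProj Θ (z - a • saddleOp (M.sampleA x) (M.sampleC x) z).fst,
        metricProj W (z - a • saddleOp (M.sampleA x) (M.sampleC x) z).snd) := by
  have h1 : (z - a • saddleOp (M.sampleA x) (M.sampleC x) z).fst =
      z.fst + a • mulE (M.sampleA x).transpose z.snd := by
    change z.fst - a • -mulE (M.sampleA x).transpose z.snd = _
    rw [smul_neg, sub_neg_eq_add]
  have h2 : (z - a • saddleOp (M.sampleA x) (M.sampleC x) z).snd =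
      z.snd + a • -(mulE (M.sampleA x) z.fst + mulE (M.sampleC x) z.snd) := by
    change z.snd - a • (mulE (M.sampleA x) z.fst + mulE (M.sampleC x) z.snd) = _
    rw [smul_neg, sub_eq_add_neg]
  rw [h1, h2, mulE_transpose_sampleA, mulE_sampleA, mulE_sampleC, ← Finset.sum_add_distrib,
    ← Finset.sum_neg_distrib, gtd2Step]
  refine congrArg (fun v => (_, metricProj W (z.snd + a • v))) (Finset.sum_congr rfl fun j _ => ?_)
  rw [← add_smul, ← neg_smul, inner_sub_left, tdDiff, distFun, distFun]
  congr 1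
  simp only [show z.ofLp.2 = z.snd from rfl, show z.ofLp.1 = z.fst from rfl]
  ring

theorem gtd2_eq_drivenIter (Θ W : Set (EuclideanSpace ℝ (Fin k))) (a : ℝ) (x : ℕ → S × S)
    (p₀ : EuclideanSpace ℝ (Fin k) × EuclideanSpace ℝ (Fin k)) (t : ℕ) :
    M.gtd2 Θ W (fun _ => a) x p₀ t =
      (drivenIter (fun (z : WithLp 2 (EuclideanSpace ℝ (Fin k) × EuclideanSpace ℝ (Fin k))) x =>
        WithLp.toLp 2 (metricProj Θ (z - a • saddleOp (M.sampleA x) (M.sampleC x) z).fst,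
          metricProj W (z - a • saddleOp (M.sampleA x) (M.sampleC x) z).snd))
        (WithLp.toLp 2 p₀) x t).ofLp := by
  induction t with
  | zero => rfl
  | succ t ih => rw [gtd2, ih, gtd2Step_eq, drivenIter]

theorem gtd2Output_const (Θ W : Set (EuclideanSpace ℝ (Fin k))) {a : ℝ} (ha : a ≠ 0)
    (x : ℕ → S × S) (p₀ : EuclideanSpace ℝ (Fin k) × EuclideanSpace ℝ (Fin k)) (n : ℕ) :
    M.gtd2Output Θ W (fun _ => a) x p₀ n =
      (n : ℝ)⁻¹ • ∑ t ∈ Finset.range n, M.gtd2 Θ W (fun _ => a) x p₀ (t + 1) := by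
  rw [gtd2Output, ← Finset.smul_sum, smul_smul, Finset.range_eq_Ico,
    Finset.sum_Ico_add' (fun t => M.gtd2 Θ W (fun _ => a) x p₀ t) 0 n 1]
  congr 1
  simp only [Finset.sum_const, Nat.card_Icc, add_tsub_cancel_right, nsmul_eq_mul]
  field_simp

variable [Fintype S]

theorem sum_smul_saddleOp_sample
    (z : WithLp 2 (EuclideanSpace ℝ (Fin k) × EuclideanSpace ℝ (Fin k))) :
    ∑ x, (M.transitionLaw x).toReal • saddleOp (M.sampleA x) (M.sampleC x) z =
      saddleOp M.matA M.matC z := by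
  rw [saddleOp, matA, matC, transpose_expect, mulE_expect, mulE_expect, mulE_expect]
  apply WithLp.ofLp_injective
  rw [WithLp.ofLp_sum]
  refine Prod.ext ?_ ?_
  · rw [Prod.fst_sum]
    simp only [saddleOp, WithLp.ofLp_smul, Prod.smul_fst, expect, smul_neg, Finset.sum_neg_distrib]
  · rw [Prod.snd_sum]
    simp only [saddleOp, WithLp.ofLp_smul, Prod.smul_snd, expect, smul_add, Finset.sum_add_distrib]

theorem sum_mul_norm_saddleOp_sub_sq
    (z : WithLp 2 (EuclideanSpace ℝ (Fin k) × EuclideanSpace ℝ (Fin k))) :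
    ∑ x, (M.transitionLaw x).toReal *
      ‖saddleOp (M.sampleA x) (M.sampleC x) z - saddleOp M.matA M.matC z‖ ^ 2 =
    M.expect (fun x => ‖mulE (M.sampleA x).transpose z.snd - mulE M.matA.transpose z.snd‖ ^ 2) +
    M.expect (fun x => ‖(mulE (M.sampleA x) z.fst + mulE (M.sampleC x) z.snd)
        - (mulE M.matA z.fst + mulE M.matC z.snd)‖ ^ 2) := by
  simp only [expect, smul_eq_mul, ← Finset.sum_add_distrib, ← mul_add]
  refine Finset.sum_congr rfl fun x _ => ?_
  rw [WithLp.prod_norm_sq_eq_of_L2]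
  congr 3
  change ‖-mulE (M.sampleA x).transpose z.snd - -mulE M.matA.transpose z.snd‖ = _
  rw [← neg_sub_neg, norm_sub_rev, neg_neg, neg_neg, norm_sub_rev]

/-- For `k > 0` a nonsingular `A` is nonzero, so the `‖A‖₂²R²` term is positive; for `k = 0` the
radius vanishes. -/
theorem gradScale_pos {Θ W : Set (EuclideanSpace ℝ (Fin k))} (hΘ : Θ.Nonempty) (hW : W.Nonempty)
    (hA : M.matA.det ≠ 0) (hR : 0 < radius Θ W) (σ₁ σ₂ : ℝ) : 0 < M.gradScale Θ W σ₁ σ₂ := by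
  rcases Nat.eq_zero_or_pos k with rfl | hk
  · have h0 : ∀ K : Set (EuclideanSpace ℝ (Fin 0)), K.Nonempty → sSup (norm '' K) = 0 := by
      intro K hK
      rw [show norm '' K = {0} from ?_, csSup_singleton]
      ext r
      have hx : ∀ x : EuclideanSpace ℝ (Fin 0), ‖x‖ = 0 := fun x => by
        rw [Subsingleton.elim x 0, norm_zero]
      simp only [Set.mem_image, Set.mem_singleton_iff, hx]
      exact ⟨fun ⟨_, _, h⟩ => h.symm, fun h => hK.imp fun x hx => ⟨hx, h.symm⟩⟩
    rw [radius, h0 Θ hΘ, h0 W hW, max_self] at hR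
    exact absurd hR (lt_irrefl _)
  · have : Nonempty (Fin k) := ⟨⟨0, hk⟩⟩
    have hA0 : 0 < specNorm M.matA := by
      refine norm_pos_iff.2 fun h => hA ?_
      rw [(map_eq_zero_iff _ (Matrix.toEuclideanCLM (n := Fin k) (𝕜 := ℝ)).injective).1 h,
        Matrix.det_zero]
    exact Real.sqrt_pos.2 (by positivity)

end LinearDistModel

end

/-! ### Assembly -/

theorem LinearDistModel.one_sub_le_measureReal_saddleErr_le
    {S A : Type*} [Fintype S] [MeasurableSpace S] [DiscreteMeasurableSpace S] [Fintype A]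
    {k m : ℕ} (M : LinearDistModel S A k m)
    {Θ W : Set (EuclideanSpace ℝ (Fin k))}
    (hΘ : IsCompact Θ) (hΘc : Convex ℝ Θ) (hΘn : Θ.Nonempty)
    (hW : IsCompact W) (hWc : Convex ℝ W) (hWn : W.Nonempty) (hA : M.matA.det ≠ 0) {σ₁ σ₂ : ℝ}
    (hσ₁ : ∀ w ∈ W,
      M.expect (fun x => ‖mulE (M.sampleA x).transpose w - mulE M.matA.transpose w‖ ^ 2) ≤ σ₁ ^ 2)
    (hσ₂ : ∀ θ ∈ Θ, ∀ w ∈ W,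
      M.expect (fun x => ‖(mulE (M.sampleA x) θ + mulE (M.sampleC x) w)
        - (mulE M.matA θ + mulE M.matC w)‖ ^ 2) ≤ σ₂ ^ 2)
    {Ω : Type*} [MeasurableSpace Ω] (μ : Measure Ω) [IsProbabilityMeasure μ]
    {X : ℕ → Ω → S × S} (hXm : ∀ t, Measurable (X t))
    (hXlaw : ∀ t, μ.map (X t) = M.transitionLaw.toMeasure) (hXindep : iIndepFun X μ)
    (p₀ : EuclideanSpace ℝ (Fin k) × EuclideanSpace ℝ (Fin k)) {δ : ℝ} (hδ₀ : 0 < δ)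
    {n : ℕ} (hn : 0 < n) :
    1 - δ ≤ μ.real {ω | saddleErr (saddleFun M.matA M.matC) Θ W
      (M.gtd2Output Θ W (fun _ => M.gtd2StepSize Θ W σ₁ σ₂ n) (fun t => X t ω) p₀ n).1
      (M.gtd2Output Θ W (fun _ => M.gtd2StepSize Θ W σ₁ σ₂ n) (fun t => X t ω) p₀ n).2 ≤
        √(10 / n) * (8 + 2 * Real.log (2 / δ)) * radius Θ W * M.gradScale Θ W σ₁ σ₂} := by
  set R := radius Θ W with hRdef
  set G := M.gradScale Θ W σ₁ σ₂ with hGdef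
  have hle : ∀ x, x ∈ Θ ∨ x ∈ W → ‖x‖ ≤ R := fun x hx => norm_le_radius hΘ hW hx
  have hR0 : 0 ≤ R := (norm_nonneg _).trans (hle _ (Or.inl hΘn.some_mem))
  have hn' : (0 : ℝ) < n := by exact_mod_cast hn
  rcases hR0.eq_or_lt with hR | hR
  -- Degenerate case `Θ = W = {0}`: the step size is `0`, so the weighted average, with `0⁻¹ = 0`,
  -- is `0` whatever `p₀` is, and the gap is `0`.
  · have hzero : ∀ x, x ∈ Θ ∨ x ∈ W → x = 0 := fun x hx =>
      norm_le_zero_iff.1 ((hle x hx).trans_eq hR.symm)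
    have hα : M.gtd2StepSize Θ W σ₁ σ₂ n = 0 := by
      rw [LinearDistModel.gtd2StepSize, ← hRdef, ← hR, mul_zero, zero_div]
    refine (by rw [probReal_univ]; linarith : 1 - δ ≤ μ.real Set.univ).trans
      (measureReal_mono fun ω _ => ?_)
    refine saddleErr_le hΘn hWn fun θ hθ w hw => ?_
    rw [hα, hzero θ (Or.inl hθ), hzero w (Or.inr hw), ← hR]
    simp [LinearDistModel.gtd2Output]
  have hG : 0 < G := M.gradScale_pos hΘn hWn hA hR σ₁ σ₂
  have hG2 : G ^ 2 = σ₁ ^ 2 + σ₂ ^ 2 + (3 * specNorm M.matA ^ 2 * R ^ 2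
      + 2 * sigmaMax M.matC ^ 2 * R ^ 2) := by
    rw [hGdef, LinearDistModel.gradScale, Real.sq_sqrt (by positivity)]
    ring
  have hs10 : √(10 * n : ℝ) ^ 2 = 10 * n := Real.sq_sqrt (by positivity)
  have hs0 : 0 < √(10 * n : ℝ) := Real.sqrt_pos.2 (by positivity)
  set a := M.gtd2StepSize Θ W σ₁ σ₂ n with ha
  have ha' : a = 4 * R / (√(10 * n) * G) := rfl
  have hapos : 0 < a := by rw [ha']; positivity
  have hP := (isProjOn_metricProj hΘ hΘc hΘn).prod (isProjOn_metricProj hW hWc hWn)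
  have main := hP.sum_inner_le_of_iIndepFun hR (fun x hx y hy => by
      have e1 := norm_sub_le x.fst y.fst
      have e2 := norm_sub_le x.snd y.snd
      have e3 : ‖(x - y).fst‖ ≤ 2 * R := by
        rw [WithLp.sub_fst]; linarith [hle _ (Or.inl hx.1), hle _ (Or.inl hy.1)]
      have e4 : ‖(x - y).snd‖ ≤ 2 * R := by
        rw [WithLp.sub_snd]; linarith [hle _ (Or.inr hx.2), hle _ (Or.inr hy.2)]
      rw [WithLp.prod_norm_sq_eq_of_L2]
      nlinarith [pow_le_pow_left₀ (norm_nonneg _) e3 2, pow_le_pow_left₀ (norm_nonneg _) e4 2])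
    (g := fun x => saddleOp (M.sampleA x) (M.sampleC x)) (fun z _ => M.sum_smul_saddleOp_sample z)
    (s := σ₁ ^ 2 + σ₂ ^ 2) (fun z hz => by
      rw [M.sum_mul_norm_saddleOp_sub_sq]
      exact add_le_add (hσ₁ _ hz.2) (hσ₂ _ hz.1 _ hz.2))
    (c := 3 * specNorm M.matA ^ 2 * R ^ 2 + 2 * sigmaMax M.matC ^ 2 * R ^ 2) (by positivity)
    (fun z hz => norm_saddleOp_sq_le (hle _ (Or.inl hz.1)) (hle _ (Or.inr hz.2)))
    -- The step size makes this an equality: `a² n G² = 16R²/10`.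
    (a := a) (n := n) (by
      rw [← hG2, ha', div_pow, mul_pow, mul_pow, hs10]
      refine le_of_eq ?_
      field_simp
      norm_num)
    hXm hXlaw hXindep (WithLp.toLp 2 p₀) hδ₀
  refine main.trans (measureReal_mono fun ω hω => ?_)
  have h := saddleErr_average_le (A := M.matA) M.inner_mulE_matC_comm M.inner_mulE_matC_self_nonneg
    hΘn hWn hn hapos hω
  rw [Set.mem_ofPred_eq, M.gtd2Output_const Θ W hapos.ne']
  simp only [M.gtd2_eq_drivenIter]
  refine h.trans (le_of_eq ?_)
  have hs : √(10 / n : ℝ) = √(10 * n) / n := by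
    rw [Real.sqrt_eq_iff_mul_self_eq (by positivity) (by positivity), div_mul_div_comm, ← sq, hs10]
    field_simp
  rw [hs, ha']
  field_simp
  ring

theorem mainTheorem4
    {S A : Type*} [Fintype S] [MeasurableSpace S] [DiscreteMeasurableSpace S] [Fintype A]
    {k m : ℕ} (M : LinearDistModel S A k m)
    (Θ W : Set (EuclideanSpace ℝ (Fin k)))
    (hΘ : IsCompact Θ) (hΘc : Convex ℝ Θ) (hW : IsCompact W) (hWc : Convex ℝ W)
    -- a saddle point of `L` over the whole space lies in `Θ × W`
    (hsaddle : ∃ θs ∈ Θ, ∃ ws ∈ W,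
      IsSaddlePointOn Set.univ Set.univ (saddleFun M.matA M.matC) θs ws)
    (hA : M.matA.det ≠ 0) (hC : M.matC.det ≠ 0)
    -- variances of the stochastic gradients
    (σ₁ σ₂ : ℝ)
    (hσ₁ : ∀ w ∈ W,
      M.expect (fun x => ‖mulE (M.sampleA x).transpose w - mulE M.matA.transpose w‖ ^ 2) ≤ σ₁ ^ 2)
    (hσ₂ : ∀ θ ∈ Θ, ∀ w ∈ W,
      M.expect (fun x => ‖(mulE (M.sampleA x) θ + mulE (M.sampleC x) w)
        - (mulE M.matA θ + mulE M.matC w)‖ ^ 2) ≤ σ₂ ^ 2)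
    -- independent random transitions `X t = (s_t, s'_t)`
    {Ω : Type*} [MeasurableSpace Ω] (μ : Measure Ω) [IsProbabilityMeasure μ]
    (X : ℕ → Ω → S × S) (hXm : ∀ t, Measurable (X t))
    (hXlaw : ∀ t, μ.map (X t) = M.transitionLaw.toMeasure)
    (hXindep : iIndepFun X μ)
    -- initial point
    (p₀ : EuclideanSpace ℝ (Fin k) × EuclideanSpace ℝ (Fin k))
    (δ : ℝ) (hδ₀ : 0 < δ) (hδ₁ : δ < 1) :
    let err : ℕ → Ω → ℝ := fun n ω =>
      let out := M.gtd2Output Θ W (fun _ => M.gtd2StepSize Θ W σ₁ σ₂ n) (fun t => X t ω) p₀ n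
      saddleErr (saddleFun M.matA M.matC) Θ W out.1 out.2
    (∀ n : ℕ, 0 < n →
      1 - δ ≤ μ.real {ω | err n ω ≤
        √(10 / n) * (8 + 2 * Real.log (2 / δ)) * radius Θ W * M.gradScale Θ W σ₁ σ₂}) ∧
    (∃ K : ℝ, ∀ n : ℕ, 0 < n → 1 - δ ≤ μ.real {ω | err n ω ≤ K * √(1 / n)}) := by
  have h1 : ∀ n : ℕ, 0 < n → 1 - δ ≤ μ.real {ω | saddleErr (saddleFun M.matA M.matC) Θ W
      (M.gtd2Output Θ W (fun _ => M.gtd2StepSize Θ W σ₁ σ₂ n) (fun t => X t ω) p₀ n).1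
      (M.gtd2Output Θ W (fun _ => M.gtd2StepSize Θ W σ₁ σ₂ n) (fun t => X t ω) p₀ n).2 ≤
        √(10 / n) * (8 + 2 * Real.log (2 / δ)) * radius Θ W * M.gradScale Θ W σ₁ σ₂} := by
    -- The saddle point supplies witnesses that `Θ` and `W` are nonempty.
    obtain ⟨θs, hθs, ws, hws, -⟩ := hsaddle
    exact fun n hn => M.one_sub_le_measureReal_saddleErr_le hΘ hΘc ⟨θs, hθs⟩ hW hWc ⟨ws, hws⟩ hA
      hσ₁ hσ₂ μ hXm hXlaw hXindep p₀ hδ₀ hn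
  refine ⟨h1, √10 * (8 + 2 * Real.log (2 / δ)) * radius Θ W * M.gradScale Θ W σ₁ σ₂,
    fun n hn => (h1 n hn).trans_eq ?_⟩
  have e : √(10 / n : ℝ) = √10 * √(1 / n) := by
    rw [← Real.sqrt_mul (by norm_num), mul_one_div]
  congr 2
  ext ω
  rw [e]
  refine Eq.to_iff (congrArg _ ?_)
  ring
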